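/- Let $T$ be a complete first-order theory in a language $L$, $|T|=|L|+\aleph_0$, and let $p(x)$ be a partial type, in a finite tuple of variables $x$, over a set of parameters $A$ in a model of $T$. Parameters and realizations below are taken in a monster model of $T$, i.e. in sufficiently large elementary extensions; $p\upharpoonright B$ is the set of formulas of $p$ all of whose parameters lie in $B$. A family of formulas $(\varphi(x,a_i):i<\omega)$ is $k$-inconsistent if no $k$ of them (with distinct indices) have a common realization. For an ordinal $\alpha$, a tree of depth $\alpha$ for $p$ consists of formulas $\varphi_j(x,y_j)\in L$ and numbers $k_j<\omega$ $(j<\alpha)$ and parameter tuples $a_{s,i}$ $(s\in\omega^{<\alpha},\ i<\omega)$ such that (a) for each $s\in\omega^{<\alpha}$, $\{\varphi_{|s|}(x,a_{s,i}):i<\omega\}$ is $k_{|s|}$-inconsistent, and (b) for each $f:\alpha\to\omega$, $p(x)\cup\{\varphi_i(x,a_{f\upharpoonright i,f(i)}):i<\alpha\}$ is consistent. The dividing depth $DD(p)$ is the supremum of the depths of the trees for $p$, and $DD(p)=\infty$ if these depths are unbounded; when $DD(p)$ is a limit ordinal $\alpha$, one distinguishes $DD(p)=\alpha_+$ (there is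 a tree of depth $\alpha$ for $p$) from $DD(p)=\alpha_-$ (there is none). The type $p$ is simple if there is no tree of depth $\omega$ for $p$ in which all the formulas $\varphi_j$ are the same formula and all the numbers $k_j$ are the same number. Then: 1. If $p$ is simple, there is a set $B\subseteq A$ with $|B|\le|T|$ such that $p\upharpoonright B$ is simple. 2. There is a set $B\subseteq A$ such that $DD(p\upharpoonright B)=DD(p)$ (including the distinction between $\alpha_+$ and $\alpha_-$) and, if $DD(p)<\infty$, $|B|\le|T|^{\max(1,|DD(p)|)}$. (So $|B|\le|T|^{|DD(p)|}$ whenever $1\le DD(p)<\infty$, and $|B|\le|T|$ when $DD(p)=0$.) -/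

import Mathlib

open FirstOrder

universe u v w

namespace DividingDepth

variable {L : FirstOrder.Language.{u, v}} {M : Type w} {n : ℕ}

/-- The cardinal `|T|` of a theory `T` in the language `L`: the number of `L`-formulas,
that is `|L| + ℵ₀`. -/
noncomputable def cardTheory (_T : L.Theory) : Cardinal.{max u v} :=
  max Cardinal.aleph0 L.card

/-- Formulas `ψ(x)` in the finite tuple of variables `x = (x₀, …, xₙ₋₁)` with parameters from `M`.
Such a formula is an `L`-formula with free variables in `M ⊕ Fin n`: the free variable `Sum.inl c`
is the parameter `c` and always gets the value `c`; the free variable `Sum.inr i` is `xᵢ`. -/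
abbrev ParamFormula (L : FirstOrder.Language.{u, v}) (M : Type w) (n : ℕ) :=
  L.Formula (M ⊕ Fin n)

open Classical in
/-- The set of parameters that appear in a formula. -/
def parameters (ψ : ParamFormula L M n) : Set M :=
  {c | Sum.inl c ∈ FirstOrder.Language.BoundedFormula.freeVarFinset ψ}

/-- `p` is a set of formulas over `A`: all parameters of all its formulas lie in `A`. -/
def IsOver (p : Set (ParamFormula L M n)) (A : Set M) : Prop :=
  ∀ ψ ∈ p, parameters ψ ⊆ A

/-- The restriction `p ↾ B`: the formulas of `p` all of whose parameters lie in `B`. -/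
def restrict (p : Set (ParamFormula L M n)) (B : Set M) : Set (ParamFormula L M n) :=
  {ψ ∈ p | parameters ψ ⊆ B}

section Trees

variable [L.Structure M]

/-- The tuple `b` of an elementary extension `N` of `M` (given by the embedding `e`) realizes
all formulas of `p`. -/
def RealizesType {N : Type*} [L.Structure N] (e : M ↪ₑ[L] N) (p : Set (ParamFormula L M n))
    (b : Fin n → N) : Prop :=
  ∀ ψ ∈ p, FirstOrder.Language.Formula.Realize ψ (Sum.elim (fun c => e c) b)

/-- The family `(φ(x, aᵢ) : i < ω)` is `k`-inconsistent: no `k` of its members (with distinct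
indices) have a common realization. A finite family has a realization in `N` if and only if it
has one in some elementary extension of `N`. -/
def KInconsistent {N : Type*} [L.Structure N] {m : ℕ} (φ : L.Formula (Fin n ⊕ Fin m))
    (a : ℕ → Fin m → N) (k : ℕ) : Prop :=
  ∀ F : Finset ℕ, F.card = k → ¬ ∃ b : Fin n → N, ∀ i ∈ F, φ.Realize (Sum.elim b (a i))

/-- There is a tree of parameters `(a_{s,i} : s ∈ ω^{<α}, i < ω)` of depth `α` for `p`, with the
sequence of formulas `(φⱼ(x, yⱼ) : j < α)` (where `yⱼ` is a tuple of length `m j`) and the sequence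
of numbers `(kⱼ : j < α)`, such that
* for each `s ∈ ω^{<α}`, of length `j` say, `{φⱼ(x, a_{s,i}) : i < ω}` is `kⱼ`-inconsistent;
* for each `f : α → ω`, `p(x) ∪ {φᵢ(x, a_{f↾i, f(i)}) : i < α}` is consistent.

The parameters and the realizations of the consistent sets are taken in a sufficiently large
elementary extension `N` of `M`, which plays the role of the monster model; so this does not
depend on a choice of such a model and makes sense for every ordinal `α`. A sequence `s ∈ ω^{<α}`
of length `j < α` is a function `s : Set.Iio j → ℕ`. -/
def HasTreeWith (p : Set (ParamFormula L M n)) (α : Ordinal.{max u v w})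
    (m : Set.Iio α → ℕ) (φ : (j : Set.Iio α) → L.Formula (Fin n ⊕ Fin (m j)))
    (k : Set.Iio α → ℕ) : Prop :=
  ∃ (N : Type (max u v w)) (_ : L.Structure N) (e : M ↪ₑ[L] N)
    (a : (j : Set.Iio α) → (Set.Iio j.1 → ℕ) → ℕ → Fin (m j) → N),
    (∀ (j : Set.Iio α) (s : Set.Iio j.1 → ℕ), KInconsistent (φ j) (a j s) (k j)) ∧
    (∀ f : Set.Iio α → ℕ, ∃ b : Fin n → N, RealizesType e p b ∧
      ∀ i : Set.Iio α, (φ i).Realize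
        (Sum.elim b (a i (fun j => f ⟨j.1, (Set.mem_Iio.mp j.2).trans i.2⟩) (f i))))

/-- There is a tree of depth `α` for `p`, written `α₊ ≤ DD(p)`. -/
def HasTree (p : Set (ParamFormula L M n)) (α : Ordinal.{max u v w}) : Prop :=
  ∃ (m : Set.Iio α → ℕ) (φ : (j : Set.Iio α) → L.Formula (Fin n ⊕ Fin (m j)))
    (k : Set.Iio α → ℕ), HasTreeWith p α m φ k

/-- The dividing depth `DD(p)`: the supremum of the depths of all trees for `p`, with value
`⊤` (that is, `∞`) when these depths are unbounded in the ordinals. -/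
noncomputable def DD (p : Set (ParamFormula L M n)) : WithTop Ordinal.{max u v w} :=
  sSup ((fun α : Ordinal.{max u v w} => (α : WithTop Ordinal.{max u v w})) '' {α | HasTree p α})

/-- The value of `DD(p)` is an ordinal `α` and there is a tree of depth `α` for `p`. When `DD(p)`
is a limit ordinal `α`, this tells `DD(p) = α₊` from `DD(p) = α₋`. -/
def DDAttained (p : Set (ParamFormula L M n)) : Prop :=
  ∃ α : Ordinal.{max u v w}, DD p = α ∧ HasTree p α

/-- `p` is simple: there are no `φ(x, y)` and `k < ω` with a tree
`(a_{s,i} : s ∈ ω^{<ω}, i < ω)` such that each `{φ(x, a_{s,i}) : i < ω}` is `k`-inconsistent and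
`p(x) ∪ {φ(x, a_{f↾i, f(i)}) : i < ω}` is consistent for each `f : ω → ω`. -/
def IsSimple (p : Set (ParamFormula L M n)) : Prop :=
  ¬ ∃ (m : ℕ) (φ : L.Formula (Fin n ⊕ Fin m)) (k : ℕ),
    HasTreeWith p Ordinal.omega0.{max u v w} (fun _ => m) (fun _ => φ) (fun _ => k)

end Trees

end DividingDepth

/-! For a fixed sequence of labels $(\varphi_j, k_j)$, the existence of a tree is compact in $p$:
trees with these labels for all finite subsets of $p$ combine in an ultraproduct into one for $p$
(`hasTreeWith_of_finite`). So the absence of such a tree is already due to finitely many parameters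
(`exists_finite_not_hasTreeWith`). The set $B$ is a union of these finite sets. Simplicity involves
only constant sequences, at most $|T|$ many; depth $\alpha$ involves at most $|T|^{|\alpha|}$
sequences. Excluding depth $DD(p)+1$ bounds the depth of $p\upharpoonright B$ from above,
monotonicity bounds it from below, and excluding depth $DD(p)$ too, when it is not attained,
preserves the sign. -/

namespace DividingDepth

open FirstOrder.Language Cardinal

/-! ### Passing to subtypes and to smaller depths. -/

section Monotonicity

variable {L : FirstOrder.Language.{u, v}} {M : Type w} {n : ℕ}

theorem finite_parameters (ψ : ParamFormula L M n) : (parameters ψ).Finite := by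
  classical
  exact (Finset.finite_toSet _).preimage Sum.inl_injective.injOn

theorem restrict_eq_self {p : Set (ParamFormula L M n)} {A : Set M} (hp : IsOver p A) :
    restrict p A = p :=
  Set.Subset.antisymm (fun _ h => h.1) fun ψ h => ⟨h, hp ψ h⟩

variable [L.Structure M]

theorem HasTreeWith.mono {p q : Set (ParamFormula L M n)} (hqp : q ⊆ p)
    {α : Ordinal.{max u v w}} {m : Set.Iio α → ℕ}
    {φ : (j : Set.Iio α) → L.Formula (Fin n ⊕ Fin (m j))} {k : Set.Iio α → ℕ}
    (h : HasTreeWith p α m φ k) : HasTreeWith q α m φ k := by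
  obtain ⟨N, iN, e, a, ha, hb⟩ := h
  refine ⟨N, iN, e, a, ha, fun f => ?_⟩
  obtain ⟨b, hb, hi⟩ := hb f
  exact ⟨b, fun ψ hψ => hb ψ (hqp hψ), hi⟩

theorem HasTree.mono {p q : Set (ParamFormula L M n)} (hqp : q ⊆ p)
    {α : Ordinal.{max u v w}} (h : HasTree p α) : HasTree q α := by
  obtain ⟨m, φ, k, h⟩ := h
  exact ⟨m, φ, k, h.mono hqp⟩

/-- Cutting a tree at a smaller height gives a tree. -/
theorem HasTree.of_le {p : Set (ParamFormula L M n)} {α β : Ordinal.{max u v w}} (hαβ : α ≤ β)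
    (h : HasTree p β) : HasTree p α := by
  obtain ⟨m, φ, k, N, iN, e, a, ha, hb⟩ := h
  let c : Set.Iio α → Set.Iio β := fun j => ⟨j.1, (Set.mem_Iio.mp j.2).trans_le hαβ⟩
  refine ⟨fun j => m (c j), fun j => φ (c j), fun j => k (c j), N, iN, e, fun j => a (c j),
    fun j => ha (c j), fun f => ?_⟩
  classical
  -- The branch is continued by zeros; its values from `α` on play no role.
  let g : Set.Iio β → ℕ := fun j => if h : j.1 < α then f ⟨j.1, h⟩ else 0
  obtain ⟨b, hb, hi⟩ := hb g
  refine ⟨b, hb, fun i => ?_⟩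
  have hg (j : Ordinal.{max u v w}) (hj : j < α) (hj' : j < β) : g ⟨j, hj'⟩ = f ⟨j, hj⟩ :=
    dif_pos hj
  convert! hi (c i) using 3
  · funext j
    exact (hg j.1 ((Set.mem_Iio.mp j.2).trans i.2) _).symm
  · exact (hg i.1 i.2 _).symm

end Monotonicity

/-! ### Ultraproducts of elementary extensions. -/

section Ultraproduct

open Filter

variable {L : FirstOrder.Language.{u, v}} {ι : Type*} (U : Ultrafilter ι) (N : ι → Type*)

/-- The element of the ultraproduct given by a family of elements of the factors. -/
def toProduct (x : ∀ i, N i) : (U : Filter ι).Product N :=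
  Quotient.mk _ x

theorem toProduct_surjective : Function.Surjective (toProduct U N) :=
  fun x => Quotient.exists_rep x

variable {U N} [∀ i, L.Structure (N i)] [∀ i, Nonempty (N i)]

/-- Łoś's theorem for formulas. -/
theorem realize_toProduct {β : Type*} (φ : L.Formula β) (x : β → ∀ i, N i) :
    (φ.Realize fun c => toProduct U N (x c)) ↔ ∀ᶠ i in U, φ.Realize fun c => x c i :=
  Ultraproduct.realize_formula_cast φ x

theorem realize_elim_toProduct {β γ : Type*} (φ : L.Formula (β ⊕ γ)) (x : β → ∀ i, N i)
    (y : γ → ∀ i, N i) :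
    φ.Realize (Sum.elim (fun c => toProduct U N (x c)) fun c => toProduct U N (y c)) ↔
      ∀ᶠ i in U, φ.Realize (Sum.elim (fun c => x c i) fun c => y c i) := by
  have h := realize_toProduct (U := U) φ (Sum.elim x y)
  convert! h using 2
  · funext c
    cases c <;> rfl
  · funext i
    congr 1
    funext c
    cases c <;> rfl

variable (U) in
/-- Elementary embeddings into the factors give one into the ultraproduct. -/
def productEmbedding {M : Type*} [L.Structure M] (e : ∀ i, M ↪ₑ[L] N i) :
    M ↪ₑ[L] (U : Filter ι).Product N where
  toFun c := toProduct U N fun i => e i c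
  map_formula' _ φ x := by
    refine (realize_toProduct φ fun c i => e i (x c)).trans ?_
    have h (i : ι) : (φ.Realize fun c => e i (x c)) ↔ φ.Realize x := (e i).map_formula φ x
    simp only [h, eventually_const]

end Ultraproduct

/-! ### Compactness for trees with fixed labels. -/

section Compactness

open Filter

variable {L : FirstOrder.Language.{u, v}} {M : Type w} {n : ℕ} [L.Structure M]

/-- The ultraproduct is indexed by the finite subsets of `p`. Parameters and branch realizations are
taken coordinatewise, which makes sense because all the trees have the same labels. -/
theorem hasTreeWith_of_finite [Nonempty M] {p : Set (ParamFormula L M n)}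
    {α : Ordinal.{max u v w}} {m : Set.Iio α → ℕ}
    {φ : (j : Set.Iio α) → L.Formula (Fin n ⊕ Fin (m j))} {k : Set.Iio α → ℕ}
    (h : ∀ q ⊆ p, q.Finite → HasTreeWith q α m φ k) : HasTreeWith p α m φ k := by
  classical
  have h' (F : Finset p) : HasTreeWith (Subtype.val '' (F : Set p)) α m φ k :=
    h _ (by simp) (F.finite_toSet.image _)
  choose N iN e a ha b hb hr using h'
  have (F : Finset p) : Nonempty (N F) := ‹Nonempty M›.map (e F)
  -- Refining `atTop` puts each formula of `p` in almost every finite subset.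
  let U : Ultrafilter (Finset p) := Ultrafilter.of atTop
  have hU : (U : Filter (Finset p)) ≤ atTop := Ultrafilter.of_le _
  refine ⟨(U : Filter (Finset p)).Product N, inferInstance, productEmbedding U e,
    fun j s i c => toProduct U N fun F => a F j s i c, fun j s G hG => ?_, fun f =>
    ⟨fun c => toProduct U N fun F => b F f c, fun ψ hψ => ?_, fun i => ?_⟩⟩
  · rintro ⟨x, hx⟩
    choose y hy using fun c => toProduct_surjective U N (x c)
    obtain rfl : (fun c => toProduct U N (y c)) = x := funext hy
    -- As `G` is finite, a common realization in the ultraproduct gives one in a single factor.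
    have hev : ∀ᶠ F in U, ∀ i ∈ G, (φ j).Realize (Sum.elim (fun c => y c F) (a F j s i)) :=
      (eventually_all_finset G).2 fun i hi => (realize_elim_toProduct (φ j) y _).1 (hx i hi)
    obtain ⟨F, hF⟩ := hev.exists
    exact ha F j s G hG ⟨fun c => y c F, hF⟩
  · refine (realize_elim_toProduct ψ (fun c F => e F c) fun c F => b F f c).2 ?_
    filter_upwards [hU (eventually_ge_atTop {⟨ψ, hψ⟩})] with F hF
    exact hb F f ψ ⟨⟨ψ, hψ⟩, hF (Finset.mem_singleton_self _), rfl⟩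
  · exact (realize_elim_toProduct (φ i) (fun c F => b F f c) _).2
      (Eventually.of_forall fun F => hr F f i)

/-- If there is no tree with given formulas and numbers for `p`, then this is so for the
restriction of `p` to any set that contains a suitable finite set of parameters. -/
theorem exists_finite_not_hasTreeWith [Nonempty M] {A : Set M} {p : Set (ParamFormula L M n)}
    (hp : IsOver p A) {α : Ordinal.{max u v w}} {m : Set.Iio α → ℕ}
    {φ : (j : Set.Iio α) → L.Formula (Fin n ⊕ Fin (m j))} {k : Set.Iio α → ℕ}
    (h : ¬ HasTreeWith p α m φ k) :
    ∃ S ⊆ A, S.Finite ∧ ∀ B, S ⊆ B → ¬ HasTreeWith (restrict p B) α m φ k := by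
  have : ∃ q ⊆ p, q.Finite ∧ ¬ HasTreeWith q α m φ k := by
    by_contra! hq
    exact h (hasTreeWith_of_finite hq)
  obtain ⟨q, hqp, hq, hn⟩ := this
  refine ⟨⋃ ψ ∈ q, parameters ψ, Set.iUnion₂_subset fun ψ hψ => hp ψ (hqp hψ),
    hq.biUnion fun ψ _ => finite_parameters ψ, fun B hB ht => hn (ht.mono fun ψ hψ => ?_)⟩
  exact ⟨hqp hψ, (Set.subset_biUnion_of_mem (u := fun ψ => parameters ψ) hψ).trans hB⟩

end Compactness

/-! ### Counting labels and bounding the parameter sets. -/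

section Counting

variable {L : FirstOrder.Language.{u, v}} {M : Type w} {n : ℕ}

variable (L n) in
/-- The possible labels of a level of a tree: a formula `φ(x, y)` with a tuple `y` of length `m`,
and a number. -/
abbrev Label := Σ m : ℕ, L.Formula (Fin n ⊕ Fin m) × ℕ

theorem aleph0_le_cardTheory (T : L.Theory) : ℵ₀ ≤ cardTheory T :=
  le_max_left _ _

theorem mk_formula_le (T : L.Theory) (β : Type) [Countable β] :
    #(L.Formula β) ≤ cardTheory T := by
  have h : #(L.Formula β) ≤ #(Σ l, L.BoundedFormula β l) :=
    mk_le_of_injective (f := fun φ => (⟨0, φ⟩ : Σ l, L.BoundedFormula β l))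
      fun _ _ h => by simpa using h
  refine h.trans (BoundedFormula.card_le.trans (max_le (le_max_left _ _) ?_))
  refine add_le_of_le (aleph0_le_cardTheory T) ?_ ?_
  · exact (lift_le_aleph0.2 mk_le_aleph0).trans (aleph0_le_cardTheory T)
  · rw [lift_uzero]
    exact le_max_right _ _

theorem mk_label_le (T : L.Theory) : #(Label L n) ≤ cardTheory T := by
  have h (m : ℕ) : #(L.Formula (Fin n ⊕ Fin m) × ℕ) ≤ cardTheory T := by
    rw [mk_prod, lift_uzero, mk_nat, lift_aleph0]
    exact mul_le_of_le (aleph0_le_cardTheory T) (mk_formula_le T _) (aleph0_le_cardTheory T)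
  rw [mk_sigma]
  refine (sum_le_lift_mk_mul_iSup _).trans (mul_le_of_le (aleph0_le_cardTheory T) ?_ (ciSup_le' h))
  rw [mk_nat, lift_aleph0]
  exact aleph0_le_cardTheory T

theorem mk_iUnion_finite_le {ι : Type u} {M : Type v} {S : ι → Set M}
    (hS : ∀ i, (S i).Finite) : lift.{u} #(⋃ i, S i) ≤ lift.{v} #ι * ℵ₀ :=
  (mk_iUnion_le_lift S).trans <| mul_le_mul_right
    (ciSup_le' fun i => lift_le_aleph0.2 (hS i).countable.le_aleph0) _

variable [L.Structure M]

theorem exists_isSimple_restrict [Nonempty M] (T : L.Theory) {A : Set M}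
    {p : Set (ParamFormula L M n)} (hp : IsOver p A) (h : IsSimple p) :
    ∃ B ⊆ A, lift.{max u v} #B ≤ lift.{w} (cardTheory T) ∧ IsSimple (restrict p B) := by
  choose S hSA hS hn using fun d : Label L n => exists_finite_not_hasTreeWith hp
    (fun ht : HasTreeWith p Ordinal.omega0.{max u v w} (fun _ => d.1) (fun _ => d.2.1)
      (fun _ => d.2.2) => h ⟨_, _, _, ht⟩)
  refine ⟨⋃ d, S d, Set.iUnion_subset hSA, ?_, ?_⟩
  · have hT : ℵ₀ ≤ lift.{w} (cardTheory T) := aleph0_le_lift.2 (aleph0_le_cardTheory T)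
    exact (mk_iUnion_finite_le hS).trans
      (mul_le_of_le hT (lift_le.2 (mk_label_le T)) hT)
  · rintro ⟨m, φ, k, ht⟩
    exact hn ⟨m, φ, k⟩ _ (Set.subset_iUnion S _) ht

theorem exists_not_hasTree_restrict [Nonempty M] (T : L.Theory) {A : Set M}
    {p : Set (ParamFormula L M n)} (hp : IsOver p A) {α : Ordinal.{max u v w}}
    (h : ¬ HasTree p α) :
    ∃ S ⊆ A, lift.{max u v} #S ≤ lift.{w} (cardTheory T) ^ max 1 α.card ∧
      ∀ B, S ⊆ B → ¬ HasTree (restrict p B) α := by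
  choose S hSA hS hn using fun d : Set.Iio α → Label L n => exists_finite_not_hasTreeWith hp
    (fun ht : HasTreeWith p α (fun j => (d j).1) (fun j => (d j).2.1) (fun j => (d j).2.2) =>
      h ⟨_, _, _, ht⟩)
  -- `Set.Iio α` lives one universe too high for the cardinal bound, so the label sequences are
  -- reindexed by `α.ToType`.
  let r : (α.ToType → Label L n) → Set.Iio α → Label L n := fun d j => d (Ordinal.ToType.mk j)
  refine ⟨⋃ d, S (r d), Set.iUnion_subset fun d => hSA _, ?_, ?_⟩
  · have hT : ℵ₀ ≤ lift.{w} (cardTheory T) := aleph0_le_lift.2 (aleph0_le_cardTheory T)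
    have hT' : lift.{w} (cardTheory T) ≠ 0 := (aleph0_pos.trans_le hT).ne'
    have hle : lift.{w} (cardTheory T) ≤ lift.{w} (cardTheory T) ^ max 1 α.card :=
      self_le_power _ (le_max_left _ _)
    have hι : #(α.ToType → Label L n) ≤ lift.{w} (cardTheory T) ^ max 1 α.card := by
      have h1 : #(α.ToType → Label L n) = lift.{w} #(Label L n) ^ α.card := by
        rw [mk_arrow, mk_toType, lift_id'.{max u v, max u v w}, lift_umax.{max u v, w}]
      rw [h1]
      exact (power_le_power_right (lift_le.2 (mk_label_le T))).trans
        (power_le_power_left hT' (le_max_right _ _))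
    have hS' := mk_iUnion_finite_le fun d => hS (r d)
    rw [lift_id'.{w, max u v w}, lift_umax.{w, max u v}] at hS'
    exact hS'.trans (mul_le_of_le (hT.trans hle) hι (hT.trans hle))
  · rintro B hB ⟨m, φ, k, ht⟩
    have hr : r (fun i => ⟨m i.toOrd, φ i.toOrd, k i.toOrd⟩) = fun j => ⟨m j, φ j, k j⟩ :=
      funext fun j => congrArg (fun i => (⟨m i, φ i, k i⟩ : Label L n))
        (Ordinal.ToType.mk.symm_apply_apply j)
    refine hn (fun j => ⟨m j, φ j, k j⟩) B ?_ ht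
    exact hr ▸ (Set.subset_iUnion (fun d => S (r d))
      fun i => ⟨m i.toOrd, φ i.toOrd, k i.toOrd⟩).trans hB

end Counting

/-! ### Preserving the dividing depth and its sign. -/

section Depth

variable {L : FirstOrder.Language.{u, v}} {M : Type w} {n : ℕ} [L.Structure M]

theorem HasTree.le_DD {p : Set (ParamFormula L M n)} {α : Ordinal.{max u v w}}
    (h : HasTree p α) : (α : WithTop Ordinal.{max u v w}) ≤ DD p :=
  le_sSup (Set.mem_image_of_mem _ h)

theorem DD_mono {p q : Set (ParamFormula L M n)} (hqp : q ⊆ p) : DD p ≤ DD q :=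
  sSup_le_sSup (Set.image_mono fun _ h => HasTree.mono hqp h)

theorem DD_le_of_not_hasTree_add_one {p : Set (ParamFormula L M n)} {α : Ordinal.{max u v w}}
    (h : ¬ HasTree p (α + 1)) : DD p ≤ α := by
  refine sSup_le ?_
  rintro _ ⟨β, hβ, rfl⟩
  refine WithTop.coe_le_coe.2 (not_lt.1 fun hlt => h (hβ.of_le (Order.add_one_le_of_lt hlt)))

theorem DDAttained_iff_of_DD_eq {p : Set (ParamFormula L M n)} {α : Ordinal.{max u v w}}
    (h : DD p = α) : DDAttained p ↔ HasTree p α := by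
  refine ⟨?_, fun ht => ⟨α, h, ht⟩⟩
  rintro ⟨β, hβ, ht⟩
  rwa [WithTop.coe_injective (h.symm.trans hβ)]

/-- Excluding depth `δ + 1` must cost no more than the bound for `δ`: a finite power of `c` is at
most `c`, and an infinite cardinal absorbs the 1. -/
theorem power_max_one_card_add_one {c : Cardinal.{u}} (hc : ℵ₀ ≤ c) (α : Ordinal.{u}) :
    c ^ max 1 (α + 1).card ≤ c ^ max 1 α.card := by
  rcases lt_or_ge α.card ℵ₀ with h | h
  · have h' : max 1 (α + 1).card < ℵ₀ := by
      rw [Ordinal.card_add_one]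
      exact max_lt one_lt_aleph0 (add_lt_aleph0 h one_lt_aleph0)
    exact (pow_le hc h').trans (self_le_power _ (le_max_left _ _))
  · rw [Ordinal.card_add_one, add_one_eq h]

theorem exists_DD_restrict_eq [Nonempty M] (T : L.Theory) {A : Set M}
    {p : Set (ParamFormula L M n)} (hp : IsOver p A) {δ : Ordinal.{max u v w}} (h : DD p = δ) :
    ∃ B ⊆ A, lift.{max u v} #B ≤ lift.{w} (cardTheory T) ^ max 1 δ.card ∧
      DD (restrict p B) = δ ∧ (HasTree (restrict p B) δ ↔ HasTree p δ) := by
  have hT : ℵ₀ ≤ lift.{w} (cardTheory T) := aleph0_le_lift.2 (aleph0_le_cardTheory T)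
  have hsub (B : Set M) : restrict p B ⊆ p := fun _ h => h.1
  have hsucc : ¬ HasTree p (δ + 1) := fun ht =>
    (lt_add_one δ).not_ge (WithTop.coe_le_coe.1 (h ▸ ht.le_DD))
  obtain ⟨S, hSA, hS, hSn⟩ := exists_not_hasTree_restrict T hp hsucc
  replace hS := hS.trans (power_max_one_card_add_one hT δ)
  have hDD (B : Set M) (hB : S ⊆ B) : DD (restrict p B) = δ :=
    (DD_le_of_not_hasTree_add_one (hSn B hB)).antisymm (h ▸ DD_mono (hsub B))
  by_cases hδ : HasTree p δ
  · exact ⟨S, hSA, hS, hDD S subset_rfl, iff_of_true (hδ.mono (hsub S)) hδ⟩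
  -- `S` already fixes the depth; `R` keeps it unattained.
  obtain ⟨R, hRA, hR, hRn⟩ := exists_not_hasTree_restrict T hp hδ
  refine ⟨S ∪ R, Set.union_subset hSA hRA, ?_, hDD _ Set.subset_union_left,
    iff_of_false (hRn _ Set.subset_union_right) hδ⟩
  refine (lift_le.2 (mk_union_le S R)).trans ?_
  rw [lift_add]
  exact add_le_of_le (hT.trans (self_le_power _ (le_max_left _ _))) hS hR

end Depth

end DividingDepth

theorem proposition3p10 {L : FirstOrder.Language.{u, v}} (T : L.Theory) (hT : T.IsComplete)
    (M : Type w) [L.Structure M] [Nonempty M] [M ⊨ T] {n : ℕ} (A : Set M)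
    (p : Set (DividingDepth.ParamFormula L M n)) (hp : DividingDepth.IsOver p A) :
    (DividingDepth.IsSimple p →
      ∃ B : Set M, B ⊆ A ∧
        Cardinal.lift.{max u v} (Cardinal.mk B) ≤
          Cardinal.lift.{w} (DividingDepth.cardTheory T) ∧
        DividingDepth.IsSimple (DividingDepth.restrict p B)) ∧
    (∃ B : Set M, B ⊆ A ∧
      (∀ δ : Ordinal.{max u v w}, DividingDepth.DD p = δ →
        Cardinal.lift.{max u v} (Cardinal.mk B) ≤
          Cardinal.lift.{w} (DividingDepth.cardTheory T) ^ (max 1 δ.card)) ∧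
      DividingDepth.DD (DividingDepth.restrict p B) = DividingDepth.DD p ∧
      (DividingDepth.DDAttained (DividingDepth.restrict p B) ↔ DividingDepth.DDAttained p)) := by
  refine ⟨DividingDepth.exists_isSimple_restrict T hp, ?_⟩
  cases h : DividingDepth.DD p with
  | top =>
    -- Infinite depth carries no cardinality bound, so `A` itself serves.
    refine ⟨A, subset_rfl, fun δ hδ => absurd hδ WithTop.top_ne_coe, ?_⟩
    rw [DividingDepth.restrict_eq_self hp]
    exact ⟨h, Iff.rfl⟩
  | coe δ =>
    obtain ⟨B, hBA, hB, hDD, hiff⟩ := DividingDepth.exists_DD_restrict_eq T hp h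
    refine ⟨B, hBA, fun δ' hδ' => ?_, hDD, ?_⟩
    · rwa [← WithTop.coe_injective hδ']
    · rw [DividingDepth.DDAttained_iff_of_DD_eq hDD, DividingDepth.DDAttained_iff_of_DD_eq h, hiff]
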